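/- Formulas are built from a denumerable set of variables with $\wedge,\vee,\to,0,1$ and a binary connective $\mathbin{\Box\!\!\to}$. Put $\neg\varphi:=\varphi\to 0$, $\varphi\leftrightarrow\psi:=(\varphi\to\psi)\wedge(\psi\to\varphi)$, $\varphi\mathbin{\Diamond\!\!\to}\psi:=\neg(\varphi\mathbin{\Box\!\!\to}\neg\psi)$, $\Box\varphi:=\neg\varphi\mathbin{\Box\!\!\to}\varphi$, $\Diamond\varphi:=\neg\Box\neg\varphi$, $\varphi\preccurlyeq\psi:=((\varphi\vee\psi)\mathbin{\Diamond\!\!\to}(\varphi\vee\psi))\to((\varphi\vee\psi)\mathbin{\Diamond\!\!\to}\varphi)$ and $\varphi\prec\psi:=\neg(\psi\preccurlyeq\varphi)$. For $\Sigma\subseteq\{W,C,N,T,S,U,A\}$, the theorems of $\mathbf{LV}\Sigma$ are the formulas obtained from the axiom schemata of classical logic, the schemata - (L1) $\varphi\mathbin{\Box\!\!\to}\varphi$, - (L2) $((\varphi\mathbin{\Box\!\!\to}\psi)\wedge(\psi\mathbin{\Box\!\!\to}\varphi))\to((\varphi\mathbin{\Box\!\!\to}\gamma)\leftrightarrow(\psi\mathbin{\Box\!\!\to}\gamma))$,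 - (L3) $((\varphi\vee\psi)\mathbin{\Box\!\!\to}\varphi)\vee((\varphi\vee\psi)\mathbin{\Box\!\!\to}\psi)\vee\big(((\varphi\vee\psi)\mathbin{\Box\!\!\to}\gamma)\leftrightarrow((\varphi\mathbin{\Box\!\!\to}\gamma)\wedge(\psi\mathbin{\Box\!\!\to}\gamma))\big)$, - (L4) $(\varphi\mathbin{\Box\!\!\to}(\psi\wedge\gamma))\leftrightarrow((\varphi\mathbin{\Box\!\!\to}\psi)\wedge(\varphi\mathbin{\Box\!\!\to}\gamma))$, and the schemata named in $\Sigma$, by modus ponens and the rule "from $\vdash\varphi\to\psi$ infer $\vdash(\gamma\mathbin{\Box\!\!\to}\varphi)\to(\gamma\mathbin{\Box\!\!\to}\psi)$". Here - $W$: $(\varphi\mathbin{\Box\!\!\to}\psi)\to(\varphi\to\psi)$; - $C$: $((\varphi\mathbin{\Box\!\!\to}\psi)\to(\varphi\to\psi))\wedge((\varphi\wedge\psi)\to(\varphi\mathbin{\Box\!\!\to}\psi))$; - $N$: $\Box\varphi\to\Diamond\varphi$; - $T$: $\Box\varphi\to\varphi$; - $S$: $(\varphi\mathbin{\Box\!\!\to}\psi)\vee(\varphi\mathbin{\Box\!\!\to}\neg\psi)$;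 - $U$: $(\Diamond\varphi\to\Box\Diamond\varphi)\wedge(\Box\varphi\to\Box\Box\varphi)$; - $A$: $((\varphi\preccurlyeq\psi)\to\Box(\varphi\preccurlyeq\psi))\wedge((\varphi\prec\psi)\to\Box(\varphi\prec\psi))$. $\Gamma\vdash_{\mathbf{LV}\Sigma}\varphi$ means that $\varphi$ is derivable from $\Gamma$ and theorems of $\mathbf{LV}\Sigma$ by modus ponens. A logic $\vdash$ is *algebraizable* if there are a quasivariety $\mathsf K$ of algebras of the same type, a finite set $\tau(x)$ of equations in one variable and a finite set $\Delta(x,y)$ of formulas in two variables such that $\Gamma\vdash\varphi\iff\tau(\Gamma)\vDash_{\mathsf K}\tau(\varphi)$ for all $\Gamma,\varphi$, and $x\approx y$ and $\tau(\Delta(x,y))$ entail each other over $\mathsf K$. A *$\mathsf V$-algebra* is a Boolean algebra with a binary operation $\mathbin{\Box\!\!\to}$ satisfying $x\mathbin{\Box\!\!\to}x=1$, $(x\mathbin{\Box\!\!\to}y)\wedge(y\mathbin{\Box\!\!\to}x)\le(x\mathbin{\Box\!\!\to}z)\leftrightarrow(y\mathbin{\Box\!\!\to}z)$, $((x\vee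 y)\mathbin{\Box\!\!\to}x)\vee((x\vee y)\mathbin{\Box\!\!\to}y)\vee(((x\vee y)\mathbin{\Box\!\!\to}z)\leftrightarrow((x\mathbin{\Box\!\!\to}z)\wedge(y\mathbin{\Box\!\!\to}z)))=1$ and $x\mathbin{\Box\!\!\to}(y\wedge z)=(x\mathbin{\Box\!\!\to}y)\wedge(x\mathbin{\Box\!\!\to}z)$; $\mathsf V\Sigma$ is the class of $\mathsf V$-algebras in which every schema of $\Sigma$ is identically $1$. **Theorem.** 1. For every $\Sigma\subseteq\{W,C,N,T,S,U,A\}$, the logic $\mathbf{LV}\Sigma$ is algebraizable if and only if it is the logic $\mathbf{LVCA}$ (that is, $\mathbf{LV}\{C,A\}$). 2. $\mathbf{LV}\Sigma=\mathbf{LVCA}$ if and only if $A\in\Sigma$ and either $C\in\Sigma$ or both $W,S\in\Sigma$. In particular $\mathbf{LV}$, $\mathbf{LVC}$ and $\mathbf{LVCS}$ are not algebraizable. 3. On the four-element Boolean algebra $\{0,a,\neg a,1\}$ let $0\mathbin{\Box\!\!\to}y=1$ for all $y$, let $(a\mathbin{\Box\!\!\to}y)$ be $0,1,0,1$ and $(\neg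 a\mathbin{\Box\!\!\to}y)$ be $0,0,1,1$ for $y=0,a,\neg a,1$ respectively, and let $(1\mathbin{\Box\!\!\to}y)$ be $0,a,\neg a,1$ for $\mathbf A$; $0,0,0,1$ for $\mathbf B$; $0,1,0,1$ for $\mathbf C$. Then $\mathbf A\in\mathsf{VCSU}$, $\mathbf B\in\mathsf{VWA}$ and $\mathbf C\in\mathsf{VTSA}$. In each of them the deductive filters of the corresponding local logic ($\mathbf{LVCSU}$, $\mathbf{LVWA}$, $\mathbf{LVTSA}$) are exactly the nonempty lattice filters, of which there are four, while the congruence filters (the classes of $1$ under congruences) are exactly the open filters (nonempty lattice filters closed under $\Box$), of which there are only two. 4. $\mathbf{LVCA}$ collapses to classical logic: $\Gamma\vdash_{\mathbf{LVCA}}\varphi$ if and only if every two-valued valuation that reads $\mathbin{\Box\!\!\to}$ as material implication and makes all of $\Gamma$ true makes $\varphi$ true. -/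

import Mathlib

universe u

namespace LewisLogic

/-! ### Formulas and algebras of the type `{∧, ∨, →, □→, 0, 1}` -/

/-- Formulas (equivalently, terms) over variables `V`; `cf φ ψ` is the counterfactual `φ □→ ψ`. -/
inductive Form (V : Type) : Type where
  | var : V → Form V
  | bot : Form V
  | top : Form V
  | and : Form V → Form V → Form V
  | or : Form V → Form V → Form V
  | imp : Form V → Form V → Form V
  | cf : Form V → Form V → Form V

namespace Form

variable {V W : Type}

/-- Simultaneous substitution: the homomorphism of formula algebras extending `σ`. -/
def subst (σ : V → Form W) : Form V → Form W
  | var v => σ v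
  | bot => bot
  | top => top
  | and φ ψ => and (φ.subst σ) (ψ.subst σ)
  | or φ ψ => or (φ.subst σ) (ψ.subst σ)
  | imp φ ψ => imp (φ.subst σ) (ψ.subst σ)
  | cf φ ψ => cf (φ.subst σ) (ψ.subst σ)

/-- `¬φ` -/
def neg (φ : Form V) : Form V := imp φ bot
/-- `φ ↔ ψ` -/
def iff (φ ψ : Form V) : Form V := and (imp φ ψ) (imp ψ φ)
/-- `φ ◇→ ψ` -/
def might (φ ψ : Form V) : Form V := neg (cf φ (neg ψ))
/-- `□φ` -/
def box (φ : Form V) : Form V := cf (neg φ) φ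
/-- `◇φ` -/
def dia (φ : Form V) : Form V := neg (box (neg φ))
/-- `φ ≼ ψ` (`φ` is at least as possible as `ψ`) -/
def preceq (φ ψ : Form V) : Form V :=
  imp (might (or φ ψ) (or φ ψ)) (might (or φ ψ) φ)
/-- `φ ≺ ψ` -/
def prec (φ ψ : Form V) : Form V := neg (preceq ψ φ)

end Form

/-- An algebra of the type of the language (no identities assumed). -/
structure Alg : Type (u + 1) where
  carrier : Type u
  bot : carrier
  top : carrier
  and : carrier → carrier → carrier
  or : carrier → carrier → carrier
  imp : carrier → carrier → carrier
  cf : carrier → carrier → carrier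

/-- The homomorphism from the formula algebra to `A` extending the assignment `h`. -/
def Alg.eval (A : Alg.{u}) {V : Type} (h : V → A.carrier) : Form V → A.carrier
  | .var v => h v
  | .bot => A.bot
  | .top => A.top
  | .and φ ψ => A.and (A.eval h φ) (A.eval h ψ)
  | .or φ ψ => A.or (A.eval h φ) (A.eval h ψ)
  | .imp φ ψ => A.imp (A.eval h φ) (A.eval h ψ)
  | .cf φ ψ => A.cf (A.eval h φ) (A.eval h ψ)

/-! ### Logics and algebraizability -/

/-- A logic: a finitary, substitution-invariant consequence relation on formulas over a
denumerable set of variables. -/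
@[ext] structure Logic where
  Entails : Set (Form ℕ) → Form ℕ → Prop
  refl : ∀ {Γ : Set (Form ℕ)} {φ : Form ℕ}, φ ∈ Γ → Entails Γ φ
  cut : ∀ {Γ Δ : Set (Form ℕ)} {φ : Form ℕ},
    (∀ δ ∈ Δ, Entails Γ δ) → Entails Δ φ → Entails Γ φ
  structural : ∀ {Γ : Set (Form ℕ)} {φ : Form ℕ} (σ : ℕ → Form ℕ),
    Entails Γ φ → Entails (Form.subst σ '' Γ) (φ.subst σ)
  finitary : ∀ {Γ : Set (Form ℕ)} {φ : Form ℕ},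
    Entails Γ φ → ∃ Γ' ⊆ Γ, Γ'.Finite ∧ Entails Γ' φ

/-- An equation `s ≈ t` is a pair of terms. -/
abbrev Equation (V : Type) : Type := Form V × Form V

/-- `A, h ⊨ s ≈ t` -/
def Alg.Sat (A : Alg.{u}) {V : Type} (h : V → A.carrier) (e : Equation V) : Prop :=
  A.eval h e.1 = A.eval h e.2

/-- Equational consequence `Θ ⊨_K Ξ` relative to a class `K` of algebras. -/
def EqEntails (K : Set Alg.{u}) (Θ Ξ : Set (Equation ℕ)) : Prop :=
  ∀ A ∈ K, ∀ h : ℕ → A.carrier, (∀ e ∈ Θ, A.Sat h e) → ∀ e ∈ Ξ, A.Sat h e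

/-- A quasiequation: finitely many equations imply an equation. -/
structure QuasiEquation where
  premises : List (Equation ℕ)
  conclusion : Equation ℕ

/-- Validity of a quasiequation in an algebra. -/
def Alg.Validates (A : Alg.{u}) (q : QuasiEquation) : Prop :=
  ∀ h : ℕ → A.carrier, (∀ e ∈ q.premises, A.Sat h e) → A.Sat h q.conclusion

/-- A quasivariety is a class of algebras axiomatized by a set of quasiequations. -/
def IsQuasivariety (K : Set Alg.{u}) : Prop :=
  ∃ Q : Set QuasiEquation, K = {A | ∀ q ∈ Q, A.Validates q}

/-- `τ(φ)`, for a set `τ` of equations in one variable. -/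
def transEq (τ : Set (Equation (Fin 1))) (φ : Form ℕ) : Set (Equation ℕ) :=
  (fun e => (e.1.subst (fun _ => φ), e.2.subst (fun _ => φ))) '' τ

/-- `τ(Γ)` -/
def transEqSet (τ : Set (Equation (Fin 1))) (Γ : Set (Form ℕ)) : Set (Equation ℕ) :=
  ⋃ γ ∈ Γ, transEq τ γ

/-- `Δ(φ, ψ)`, for a set `Δ` of formulas in two variables. -/
def transForm (Δ : Set (Form (Fin 2))) (φ ψ : Form ℕ) : Set (Form ℕ) :=
  (fun d => d.subst ![φ, ψ]) '' Δ

/-- `K` is an equivalent algebraic semantics of the logic `L`, as witnessed by the finite set `τ`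
of defining equations and the finite set `Δ` of equivalence formulas. -/
structure IsEquivalentSemantics (L : Logic) (K : Set Alg.{u})
    (τ : Set (Equation (Fin 1))) (Δ : Set (Form (Fin 2))) : Prop where
  quasivariety : IsQuasivariety K
  finite_eqs : τ.Finite
  finite_forms : Δ.Finite
  entails_iff : ∀ (Γ : Set (Form ℕ)) (φ : Form ℕ),
    L.Entails Γ φ ↔ EqEntails K (transEqSet τ Γ) (transEq τ φ)
  eq_entails : EqEntails K {(.var 0, .var 1)}
    (transEqSet τ (transForm Δ (.var 0) (.var 1)))
  entails_eq : EqEntails K (transEqSet τ (transForm Δ (.var 0) (.var 1)))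
    {(.var 0, .var 1)}

/-- Blok–Pigozzi algebraizability. -/
def Algebraizable (L : Logic) : Prop :=
  ∃ (K : Set Alg.{u}) (τ : Set (Equation (Fin 1))) (Δ : Set (Form (Fin 2))),
    IsEquivalentSemantics L K τ Δ

/-! ### Lewis's local logics -/

/-- The letters naming the additional schemata of Lewis's hierarchy. -/
inductive Letter : Type where
  | W | C | N | T | S | U | A

open Form in
/-- The schema named by a letter (`N`, `T` and `U` do not involve `ψ`). -/
def Letter.schema {V : Type} : Letter → Form V → Form V → Form V
  | .W, φ, ψ => imp (cf φ ψ) (imp φ ψ)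
  | .C, φ, ψ => and (imp (cf φ ψ) (imp φ ψ)) (imp (and φ ψ) (cf φ ψ))
  | .N, φ, _ => imp (box φ) (dia φ)
  | .T, φ, _ => imp (box φ) φ
  | .S, φ, ψ => or (cf φ ψ) (cf φ (neg ψ))
  | .U, φ, _ => and (imp (dia φ) (box (dia φ))) (imp (box φ) (box (box φ)))
  | .A, φ, ψ => and (imp (preceq φ ψ) (box (preceq φ ψ))) (imp (prec φ ψ) (box (prec φ ψ)))

open Form in
/-- The theorems of `LV` extended by the schemata in `E`: classical schemata, (L1)-(L4), the
schemata in `E`, closed under modus ponens and the rule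
"from `⊢ φ → ψ` infer `⊢ (γ □→ φ) → (γ □→ ψ)`". -/
inductive Thm (E : Set Letter) : Form ℕ → Prop where
  | imp_k (φ ψ : Form ℕ) : Thm E (imp φ (imp ψ φ))
  | imp_s (φ ψ γ : Form ℕ) :
      Thm E (imp (imp φ (imp ψ γ)) (imp (imp φ ψ) (imp φ γ)))
  | and_left (φ ψ : Form ℕ) : Thm E (imp (and φ ψ) φ)
  | and_right (φ ψ : Form ℕ) : Thm E (imp (and φ ψ) ψ)
  | and_intro (φ ψ : Form ℕ) : Thm E (imp φ (imp ψ (and φ ψ)))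
  | or_left (φ ψ : Form ℕ) : Thm E (imp φ (or φ ψ))
  | or_right (φ ψ : Form ℕ) : Thm E (imp ψ (or φ ψ))
  | or_elim (φ ψ γ : Form ℕ) :
      Thm E (imp (imp φ γ) (imp (imp ψ γ) (imp (or φ ψ) γ)))
  | bot_elim (φ : Form ℕ) : Thm E (imp bot φ)
  | top_intro : Thm E top
  | dne (φ : Form ℕ) : Thm E (imp (neg (neg φ)) φ)
  | l1 (φ : Form ℕ) : Thm E (cf φ φ)
  | l2 (φ ψ γ : Form ℕ) :
      Thm E (imp (and (cf φ ψ) (cf ψ φ)) (iff (cf φ γ) (cf ψ γ)))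
  | l3 (φ ψ γ : Form ℕ) :
      Thm E (or (or (cf (or φ ψ) φ) (cf (or φ ψ) ψ))
        (iff (cf (or φ ψ) γ) (and (cf φ γ) (cf ψ γ))))
  | l4 (φ ψ γ : Form ℕ) :
      Thm E (iff (cf φ (and ψ γ)) (and (cf φ ψ) (cf φ γ)))
  | ext (l : Letter) (hl : l ∈ E) (φ ψ : Form ℕ) : Thm E (l.schema φ ψ)
  | mp {φ ψ : Form ℕ} : Thm E φ → Thm E (imp φ ψ) → Thm E ψ
  | wc {φ ψ : Form ℕ} (γ : Form ℕ) : Thm E (imp φ ψ) → Thm E (imp (cf γ φ) (cf γ ψ))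

/-- Local derivability: from premises and theorems, by modus ponens only. -/
inductive Der (E : Set Letter) (Γ : Set (Form ℕ)) : Form ℕ → Prop where
  | hyp {φ : Form ℕ} : φ ∈ Γ → Der E Γ φ
  | thm {φ : Form ℕ} : Thm E φ → Der E Γ φ
  | mp {φ ψ : Form ℕ} : Der E Γ φ → Der E Γ (.imp φ ψ) → Der E Γ ψ

theorem Letter.schema_subst (l : Letter) (σ : ℕ → Form ℕ) (φ ψ : Form ℕ) :
    (l.schema φ ψ).subst σ = l.schema (φ.subst σ) (ψ.subst σ) := by
  cases l <;> rfl

theorem Thm.subst {E : Set Letter} (σ : ℕ → Form ℕ) {φ : Form ℕ} (h : Thm E φ) :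
    Thm E (φ.subst σ) := by
  induction h with
  | imp_k => exact .imp_k _ _
  | imp_s => exact .imp_s _ _ _
  | and_left => exact .and_left _ _
  | and_right => exact .and_right _ _
  | and_intro => exact .and_intro _ _
  | or_left => exact .or_left _ _
  | or_right => exact .or_right _ _
  | or_elim => exact .or_elim _ _ _
  | bot_elim => exact .bot_elim _
  | top_intro => exact .top_intro
  | dne => exact .dne _
  | l1 => exact .l1 _
  | l2 => exact .l2 _ _ _
  | l3 => exact .l3 _ _ _
  | l4 => exact .l4 _ _ _
  | ext l hl φ ψ => rw [Letter.schema_subst]; exact .ext l hl _ _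
  | mp _ _ ih₁ ih₂ => exact .mp ih₁ ih₂
  | wc γ _ ih => exact .wc _ ih

theorem Der.cut {E : Set Letter} {Γ Δ : Set (Form ℕ)} {φ : Form ℕ}
    (hΔ : ∀ δ ∈ Δ, Der E Γ δ) (h : Der E Δ φ) : Der E Γ φ := by
  induction h with
  | hyp h => exact hΔ _ h
  | thm h => exact .thm h
  | mp _ _ ih₁ ih₂ => exact .mp ih₁ ih₂

theorem Der.subst {E : Set Letter} {Γ : Set (Form ℕ)} {φ : Form ℕ} (σ : ℕ → Form ℕ)
    (h : Der E Γ φ) : Der E (Form.subst σ '' Γ) (φ.subst σ) := by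
  induction h with
  | hyp h => exact .hyp ⟨_, h, rfl⟩
  | thm h => exact .thm (h.subst σ)
  | mp _ _ ih₁ ih₂ => exact .mp ih₁ ih₂

theorem Der.finitary {E : Set Letter} {Γ : Set (Form ℕ)} {φ : Form ℕ}
    (h : Der E Γ φ) : ∃ Γ' ⊆ Γ, Γ'.Finite ∧ Der E Γ' φ := by
  induction h with
  | @hyp φ h =>
    exact ⟨{φ}, Set.singleton_subset_iff.2 h, Set.finite_singleton φ, .hyp rfl⟩
  | thm h => exact ⟨∅, Set.empty_subset _, Set.finite_empty, .thm h⟩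
  | mp _ _ ih₁ ih₂ =>
    obtain ⟨Γ₁, h₁, f₁, d₁⟩ := ih₁
    obtain ⟨Γ₂, h₂, f₂, d₂⟩ := ih₂
    exact ⟨Γ₁ ∪ Γ₂, Set.union_subset h₁ h₂, f₁.union f₂,
      .mp (d₁.cut fun δ hδ => .hyp (Or.inl hδ)) (d₂.cut fun δ hδ => .hyp (Or.inr hδ))⟩

/-- The local logic `LV` extended by the schemata named in `E`; for instance `LV ∅` is **LV** and
`LV {.C, .A}` is **LVCA**. -/
def LV (E : Set Letter) : Logic where
  Entails := Der E
  refl := .hyp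
  cut := Der.cut
  structural σ h := h.subst σ
  finitary := Der.finitary

/-- The two-valued truth value of a formula, with `□→` read as material implication. -/
def Form.Truth (v : ℕ → Prop) : Form ℕ → Prop
  | .var n => v n
  | .bot => False
  | .top => True
  | .and φ ψ => φ.Truth v ∧ ψ.Truth v
  | .or φ ψ => φ.Truth v ∨ ψ.Truth v
  | .imp φ ψ => φ.Truth v → ψ.Truth v
  | .cf φ ψ => φ.Truth v → ψ.Truth v

/-! ### `V`-algebras and their filters -/

namespace Alg

variable (A : Alg.{u})

def neg (x : A.carrier) : A.carrier := A.imp x A.bot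
def iff (x y : A.carrier) : A.carrier := A.and (A.imp x y) (A.imp y x)
def box (x : A.carrier) : A.carrier := A.cf (A.neg x) x
/-- The lattice order. -/
def le (x y : A.carrier) : Prop := A.and x y = x

/-- The reduct without `□→` is a Boolean algebra. -/
def IsBoolean : Prop :=
  ∃ _ : BooleanAlgebra A.carrier,
    A.bot = ⊥ ∧ A.top = ⊤ ∧ (∀ x y, A.and x y = x ⊓ y) ∧ (∀ x y, A.or x y = x ⊔ y) ∧
      ∀ x y, A.imp x y = x ⇨ y

/-- Lewis variably strict conditional algebras. -/
structure IsVAlgebra : Prop where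
  boolean : A.IsBoolean
  c1 : ∀ x, A.cf x x = A.top
  c2 : ∀ x y z, A.le (A.and (A.cf x y) (A.cf y x)) (A.iff (A.cf x z) (A.cf y z))
  c3 : ∀ x y z, A.or (A.or (A.cf (A.or x y) x) (A.cf (A.or x y) y))
    (A.iff (A.cf (A.or x y) z) (A.and (A.cf x z) (A.cf y z))) = A.top
  c4 : ∀ x y z, A.cf x (A.and y z) = A.and (A.cf x y) (A.cf x z)

/-- Nonempty lattice filters (the whole algebra included). -/
structure IsLatticeFilter (F : Set A.carrier) : Prop where
  nonempty : F.Nonempty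
  and_mem : ∀ x ∈ F, ∀ y ∈ F, A.and x y ∈ F
  up_mem : ∀ x ∈ F, ∀ y, A.le x y → y ∈ F

/-- Open filters: nonempty lattice filters closed under `□`. -/
def IsOpenFilter (F : Set A.carrier) : Prop :=
  A.IsLatticeFilter F ∧ ∀ x ∈ F, A.box x ∈ F

/-- Congruences: equivalence relations compatible with all operations. -/
structure IsCongruence (r : A.carrier → A.carrier → Prop) : Prop where
  equivalence : Equivalence r
  and_congr : ∀ x x' y y', r x x' → r y y' → r (A.and x y) (A.and x' y')
  or_congr : ∀ x x' y y', r x x' → r y y' → r (A.or x y) (A.or x' y')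
  imp_congr : ∀ x x' y y', r x x' → r y y' → r (A.imp x y) (A.imp x' y')
  cf_congr : ∀ x x' y y', r x x' → r y y' → r (A.cf x y) (A.cf x' y')

/-- Congruence filters: the classes of `1` under congruences. -/
def IsCongruenceFilter (F : Set A.carrier) : Prop :=
  ∃ r : A.carrier → A.carrier → Prop, A.IsCongruence r ∧ F = {x | r x A.top}

/-- Deductive filters of `A` with respect to a logic. -/
def IsDeductiveFilter (L : Logic) (F : Set A.carrier) : Prop :=
  ∀ (Γ : Set (Form ℕ)) (φ : Form ℕ), L.Entails Γ φ →
    ∀ h : ℕ → A.carrier, (∀ γ ∈ Γ, A.eval h γ ∈ F) → A.eval h φ ∈ F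

end Alg

/-- The variety of `V`-algebras satisfying `χ ≈ 1` for each schema `χ` named in `E`. -/
def variety (E : Set Letter) : Set Alg.{u} :=
  {A | A.IsVAlgebra ∧ ∀ l ∈ E, ∀ h : Fin 2 → A.carrier,
    A.eval h (l.schema (.var 0) (.var 1)) = A.top}

/-! ### Three four-element algebras -/

/-- The four-element Boolean algebra, with `0 = (false, false)`, `a = (true, false)`,
`¬a = (false, true)`, `1 = (true, true)`, equipped with an operation `□→` whose rows for `0`, `a`
and `¬a` are `(1,1,1,1)`, `(0,1,0,1)`, `(0,0,1,1)` (columns `0, a, ¬a, 1`) and whose row for `1` is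
`(0, p, q, 1)`. -/
def four (p q : Bool × Bool) : Alg.{0} where
  carrier := Bool × Bool
  bot := ⊥
  top := ⊤
  and x y := x ⊓ y
  or x y := x ⊔ y
  imp x y := x ⇨ y
  cf
    | (false, false), _ => (true, true)
    | (true, false), (false, false) => (false, false)
    | (true, false), (true, false) => (true, true)
    | (true, false), (false, true) => (false, false)
    | (true, false), (true, true) => (true, true)
    | (false, true), (false, false) => (false, false)
    | (false, true), (true, false) => (false, false)
    | (false, true), (false, true) => (true, true)
    | (false, true), (true, true) => (true, true)
    | (true, true), (false, false) => (false, false)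
    | (true, true), (true, false) => p
    | (true, true), (false, true) => q
    | (true, true), (true, true) => (true, true)

/-- `1 □→ a = a` and `1 □→ ¬a = ¬a`. -/
def algA : Alg.{0} := four (true, false) (false, true)
/-- `1 □→ a = 0` and `1 □→ ¬a = 0`. -/
def algB : Alg.{0} := four (false, false) (false, false)
/-- `1 □→ a = 1` and `1 □→ ¬a = 0`. -/
def algC : Alg.{0} := four (true, true) (false, false)

/-- `A` lies in the variety of `E`; its deductive filters for the local logic of `E` are its
lattice filters, and there are four; its congruence filters are its open filters, and there are
only two. -/
structure FilterMismatch (E : Set Letter) (A : Alg.{u}) : Prop where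
  mem_variety : A ∈ variety.{u} E
  deductive_iff : ∀ F, A.IsDeductiveFilter (LV E) F ↔ A.IsLatticeFilter F
  congruence_iff : ∀ F, A.IsCongruenceFilter F ↔ A.IsOpenFilter F
  card_lattice : {F | A.IsLatticeFilter F}.ncard = 4
  card_open : {F | A.IsOpenFilter F}.ncard = 2

end LewisLogic

/-!
The proof rests on two facts.

*Failure of algebraizability.* If `Δ` is a set of equivalence formulas for an algebraizable logic and
`F` is a deductive filter of an algebra `M`, then `{(x, y) | Δ(x, y) ⊆ F}` is a congruence of `M`
(`IsEquivalentSemantics.isCongruence_leibniz`), and `F` can be recovered from it by means of the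
defining equations (`IsEquivalentSemantics.mem_iff_leibniz`). Hence an algebra has at least as many
congruences as deductive filters. By soundness (`thm_sound`), every lattice filter of an algebra in
the variety of `E` is a deductive filter of `LV E`. The algebras `four p q` have four lattice
filters; but `□x = 0` for every `x ≠ 1`, so they are simple and have only two congruences. The
algebra `algA` validates every schema except `A`, `algB` every schema except `C` and `S`, and `algC`
every schema except `W` and `C`, and so every set of letters `E` which fails the condition
`A ∈ E ∧ (C ∈ E ∨ (W ∈ E ∧ S ∈ E))` has one of them in its variety (`exists_four_mem_variety`).

*Collapse.* In the presence of `C`, the formula `φ ≼ ¬φ` is equivalent to `φ`, so that `A` yields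
`φ → □φ`. Thus `φ □→ ψ` holds as soon as `φ` fails, and by `C` it is equivalent to `φ → ψ`
(`IsMaxConsistent.cf_mem_iff`). `W` and `S` together entail `C`. Propositional reasoning in the
calculus is carried out by means of membership in maximal consistent sets, and the same sets give
completeness with respect to two-valued valuations (`der_iff_truth`). All schemata hold under the
reading of `□→` as material implication, so that all collapsing logics coincide. The
common logic is algebraizable, its equivalent semantics being the quasivariety generated by the
two-element algebra (`algebraizable_of_der_iff_truth`).
-/

namespace LewisLogic

/-! ### Evaluation and substitution -/

theorem Alg.eval_subst (A : Alg.{u}) {V W : Type} (h : W → A.carrier) (σ : V → Form W)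
    (φ : Form V) : A.eval h (φ.subst σ) = A.eval (fun v => A.eval h (σ v)) φ := by
  induction φ <;> simp_all [Form.subst, Alg.eval]

theorem Alg.eval_schema (A : Alg.{u}) {V : Type} (h : V → A.carrier) (l : Letter)
    (φ ψ : Form V) :
    A.eval h (l.schema φ ψ) = A.eval ![A.eval h φ, A.eval h ψ] (l.schema (.var 0) (.var 1)) := by
  cases l <;> rfl

/-! ### Congruences induced by deductive filters of algebraizable logics -/

/-- The relation `{(x, y) | Δ(x, y) ⊆ F}` on an algebra. If `Δ` is the set of equivalence formulas of
an algebraizable logic and `F` is a deductive filter, it is the Leibniz congruence of `F`. -/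
def Alg.leibniz (M : Alg.{u}) (Δ : Set (Form (Fin 2))) (F : Set M.carrier)
    (x y : M.carrier) : Prop :=
  ∀ d ∈ Δ, M.eval ![x, y] d ∈ F

theorem Alg.eval_subst_pair (A : Alg.{u}) {V : Type} (h : V → A.carrier) (φ ψ : Form V)
    (d : Form (Fin 2)) :
    A.eval h (d.subst ![φ, ψ]) = A.eval ![A.eval h φ, A.eval h ψ] d := by
  rw [A.eval_subst]
  congr 1
  funext i
  fin_cases i <;> rfl

theorem Alg.sat_transEq (A : Alg.{u}) (h : ℕ → A.carrier) (τ : Set (Equation (Fin 1)))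
    (φ : Form ℕ) :
    (∀ e ∈ transEq τ φ, A.Sat h e) ↔ ∀ t ∈ τ, A.Sat (fun _ => A.eval h φ) t := by
  simp only [transEq, Set.forall_mem_image, Alg.Sat, A.eval_subst]

theorem Alg.sat_transEqSet (A : Alg.{u}) (h : ℕ → A.carrier) (τ : Set (Equation (Fin 1)))
    (Γ : Set (Form ℕ)) :
    (∀ e ∈ transEqSet τ Γ, A.Sat h e) ↔
      ∀ γ ∈ Γ, ∀ t ∈ τ, A.Sat (fun _ => A.eval h γ) t := by
  simp only [← A.sat_transEq, transEqSet, Set.mem_iUnion]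
  exact ⟨fun H γ hγ e he => H e ⟨γ, hγ, he⟩, fun H e ⟨γ, hγ, he⟩ => H γ hγ e he⟩

section Leibniz

universe w

variable {L : Logic} {K : Set Alg.{w}} {τ : Set (Equation (Fin 1))} {Δ : Set (Form (Fin 2))}

/-- In the algebras of an equivalent semantics, `τ(Δ(a, b))` expresses equality of `a` and `b`. -/
theorem IsEquivalentSemantics.sat_iff_eq (H : IsEquivalentSemantics L K τ Δ) {B : Alg.{w}}
    (hB : B ∈ K) (a b : B.carrier) :
    (∀ d ∈ Δ, ∀ t ∈ τ, B.Sat (fun _ => B.eval ![a, b] d) t) ↔ a = b := by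
  have key : (∀ e ∈ transEqSet τ (transForm Δ (.var 0) (.var 1)),
      B.Sat (fun n : ℕ => if n = 0 then a else b) e) ↔
      ∀ d ∈ Δ, ∀ t ∈ τ, B.Sat (fun _ => B.eval ![a, b] d) t := by
    rw [B.sat_transEqSet]
    simp only [transForm, Set.forall_mem_image, B.eval_subst_pair]
    rfl
  rw [← key]
  constructor
  · intro h
    simpa [Alg.Sat, Alg.eval] using H.entails_eq B hB _ h _ rfl
  · intro h
    refine H.eq_entails B hB _ ?_
    simpa [Alg.Sat, Alg.eval] using h

/-- The relation induced by a deductive filter is closed under equational consequence in `K`. -/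
theorem IsEquivalentSemantics.leibniz_of_eqEntails (H : IsEquivalentSemantics L K τ Δ)
    {M : Alg.{u}} {F : Set M.carrier} (hF : M.IsDeductiveFilter L F) {P : Set (Equation ℕ)}
    {e : Equation ℕ} (hP : EqEntails K P {e}) (h : ℕ → M.carrier)
    (hh : ∀ p ∈ P, M.leibniz Δ F (M.eval h p.1) (M.eval h p.2)) :
    M.leibniz Δ F (M.eval h e.1) (M.eval h e.2) := by
  intro d hd
  rw [← M.eval_subst_pair]
  refine hF (⋃ p ∈ P, transForm Δ p.1 p.2) _ ?_ h ?_
  · rw [H.entails_iff]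
    intro B hB g hg
    rw [B.sat_transEqSet] at hg
    rw [B.sat_transEq, B.eval_subst_pair]
    refine (H.sat_iff_eq hB _ _).2 (hP B hB g (fun p hp => ?_) e rfl) d hd
    refine (H.sat_iff_eq hB _ _).1 fun d' hd' => ?_
    rw [← B.eval_subst_pair]
    exact hg _ (Set.mem_biUnion hp ⟨d', hd', rfl⟩)
  · intro γ hγ
    obtain ⟨p, hp, d', hd', rfl⟩ := Set.mem_iUnion₂.1 hγ
    change M.eval h (d'.subst ![p.1, p.2]) ∈ F
    rw [M.eval_subst_pair]
    exact hh p hp d' hd'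

/-- A deductive filter is recovered from the congruence it induces by the defining equations. -/
theorem IsEquivalentSemantics.mem_iff_leibniz (H : IsEquivalentSemantics L K τ Δ)
    {M : Alg.{u}} {F : Set M.carrier} (hF : M.IsDeductiveFilter L F) (x : M.carrier) :
    x ∈ F ↔ ∀ t ∈ τ, M.leibniz Δ F (M.eval (fun _ => x) t.1) (M.eval (fun _ => x) t.2) := by
  -- `t.1` and `t.2`, as formulas in the variable `0`
  let s : Form (Fin 1) → Form ℕ := Form.subst fun _ => .var 0
  have hs (A : Alg) (h : ℕ → A.carrier) (φ) : A.eval h (s φ) = A.eval (fun _ => h 0) φ :=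
    A.eval_subst _ _ _
  -- the same fact, in the universe of the algebras of `K`
  have hs' (A : Alg) (h : ℕ → A.carrier) (φ) : A.eval h (s φ) = A.eval (fun _ => h 0) φ :=
    A.eval_subst _ _ _
  constructor
  · intro hx t ht d hd
    have := hF {.var 0} (d.subst ![s t.1, s t.2]) ?_ (fun _ => x) (by simpa [Alg.eval] using hx)
    · rwa [M.eval_subst_pair, hs, hs] at this
    · rw [H.entails_iff]
      intro B hB g hg
      rw [B.sat_transEqSet] at hg
      rw [B.sat_transEq, B.eval_subst_pair, hs', hs']
      exact (H.sat_iff_eq hB _ _).2 (hg _ rfl t ht) d hd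
  · intro hx
    refine hF (⋃ t ∈ τ, transForm Δ (s t.1) (s t.2)) (.var 0) ?_ (fun _ => x) ?_
    · rw [H.entails_iff]
      intro B hB g hg
      rw [B.sat_transEqSet] at hg
      rw [B.sat_transEq]
      intro t ht
      have := (H.sat_iff_eq hB (B.eval g (s t.1)) (B.eval g (s t.2))).1 fun d hd => by
        rw [← B.eval_subst_pair]
        exact hg _ (Set.mem_biUnion ht ⟨d, hd, rfl⟩)
      rwa [hs', hs'] at this
    · intro γ hγ
      obtain ⟨t, ht, d, hd, rfl⟩ := Set.mem_iUnion₂.1 hγ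
      change M.eval _ (d.subst ![s t.1, s t.2]) ∈ F
      rw [M.eval_subst_pair, hs, hs]
      exact hx t ht d hd

theorem IsEquivalentSemantics.isCongruence_leibniz (H : IsEquivalentSemantics L K τ Δ)
    {M : Alg.{u}} {F : Set M.carrier} (hF : M.IsDeductiveFilter L F) :
    M.IsCongruence (M.leibniz Δ F) := by
  -- an assignment of four given values to the variables `0`, `1`, `2`, `3`
  let g (a b c d : M.carrier) : ℕ → M.carrier
    | 0 => a | 1 => b | 2 => c | _ => d
  -- compatibility with a binary operation given by a term `o`
  have bin (o : Form ℕ → Form ℕ → Form ℕ)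
      (ho : ∀ B ∈ K, ∀ h : ℕ → B.carrier, h 0 = h 1 → h 2 = h 3 →
        B.eval h (o (.var 0) (.var 2)) = B.eval h (o (.var 1) (.var 3)))
      (a b c d : M.carrier) (hab : M.leibniz Δ F a b) (hcd : M.leibniz Δ F c d) :
      M.leibniz Δ F (M.eval (g a b c d) (o (.var 0) (.var 2)))
        (M.eval (g a b c d) (o (.var 1) (.var 3))) := by
    refine H.leibniz_of_eqEntails hF
      (P := {(.var 0, .var 1), (.var 2, .var 3)}) (e := (o (.var 0) (.var 2), o (.var 1) (.var 3)))
      ?_ (g a b c d) ?_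
    · rintro B hB h hh e rfl
      exact ho B hB h (hh _ (Or.inl rfl)) (hh _ (Or.inr rfl))
    · rintro p (rfl | rfl)
      exacts [hab, hcd]
  refine ⟨⟨fun x => ?_, fun {x y} hxy => ?_, fun {x y z} hxy hyz => ?_⟩, ?_, ?_, ?_, ?_⟩
  · refine H.leibniz_of_eqEntails hF (P := ∅) (e := (.var 0, .var 0)) ?_ (fun _ => x) (by simp)
    rintro B hB h hh e rfl
    rfl
  · refine H.leibniz_of_eqEntails hF (P := {(.var 0, .var 1)}) (e := (.var 1, .var 0)) ?_
      (g x y y y) ?_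
    · rintro B hB h hh e rfl
      exact (hh _ rfl).symm
    · rintro p rfl
      exact hxy
  · refine H.leibniz_of_eqEntails hF (P := {(.var 0, .var 1), (.var 1, .var 2)})
      (e := (.var 0, .var 2)) ?_ (g x y z z) ?_
    · rintro B hB h hh e rfl
      exact (hh _ (Or.inl rfl)).trans (hh _ (Or.inr rfl))
    · rintro p (rfl | rfl)
      exacts [hxy, hyz]
  · exact fun a b c d => bin .and (fun B _ h h₁ h₂ => by simp [Alg.eval, h₁, h₂]) a b c d
  · exact fun a b c d => bin .or (fun B _ h h₁ h₂ => by simp [Alg.eval, h₁, h₂]) a b c d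
  · exact fun a b c d => bin .imp (fun B _ h h₁ h₂ => by simp [Alg.eval, h₁, h₂]) a b c d
  · exact fun a b c d => bin .cf (fun B _ h h₁ h₂ => by simp [Alg.eval, h₁, h₂]) a b c d

/-- An algebra with three distinct deductive filters whose congruences are trivial refutes
algebraizability. -/
theorem not_algebraizable_of_simple {M : Alg.{u}}
    (hM : ∀ r, M.IsCongruence r → (∀ x y, r x y ↔ x = y) ∨ ∀ x y, r x y)
    {F₁ F₂ F₃ : Set M.carrier} (h₁ : M.IsDeductiveFilter L F₁) (h₂ : M.IsDeductiveFilter L F₂)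
    (h₃ : M.IsDeductiveFilter L F₃) (h₁₂ : F₁ ≠ F₂) (h₁₃ : F₁ ≠ F₃) (h₂₃ : F₂ ≠ F₃) :
    ¬ Algebraizable.{w} L := by
  rintro ⟨K, τ, Δ, H⟩
  have inj {F G} (hF : M.IsDeductiveFilter L F) (hG : M.IsDeductiveFilter L G)
      (h : ∀ x y, M.leibniz Δ F x y ↔ M.leibniz Δ G x y) : F = G := by
    ext x
    rw [H.mem_iff_leibniz hF, H.mem_iff_leibniz hG]
    simp only [h]
  have eq {F G} (hF : M.IsDeductiveFilter L F) (hG : M.IsDeductiveFilter L G)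
      (h : ∀ x y, M.leibniz Δ F x y ↔ x = y) (h' : ∀ x y, M.leibniz Δ G x y ↔ x = y) : F = G :=
    inj hF hG fun x y => (h x y).trans (h' x y).symm
  have all {F G} (hF : M.IsDeductiveFilter L F) (hG : M.IsDeductiveFilter L G)
      (h : ∀ x y, M.leibniz Δ F x y) (h' : ∀ x y, M.leibniz Δ G x y) : F = G :=
    inj hF hG fun x y => iff_of_true (h x y) (h' x y)
  -- two of the three filters induce the same congruence
  rcases hM _ (H.isCongruence_leibniz h₁) with c₁ | c₁ <;>
  rcases hM _ (H.isCongruence_leibniz h₂) with c₂ | c₂ <;>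
  rcases hM _ (H.isCongruence_leibniz h₃) with c₃ | c₃ <;>
  first
    | exact h₁₂ (eq h₁ h₂ c₁ c₂)
    | exact h₁₂ (all h₁ h₂ c₁ c₂)
    | exact h₁₃ (eq h₁ h₃ c₁ c₃)
    | exact h₁₃ (all h₁ h₃ c₁ c₃)
    | exact h₂₃ (eq h₂ h₃ c₂ c₃)
    | exact h₂₃ (all h₂ h₃ c₂ c₃)

end Leibniz

/-! ### Soundness of the local logics in their varieties -/

theorem variety_anti {E E' : Set Letter} (h : E ⊆ E') : variety.{u} E' ⊆ variety E :=
  fun _ hA => ⟨hA.1, fun l hl => hA.2 l (h hl)⟩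

theorem thm_sound {E : Set Letter} {A : Alg.{u}} (hA : A ∈ variety E) {φ : Form ℕ}
    (h : Thm E φ) (g : ℕ → A.carrier) : A.eval g φ = A.top := by
  obtain ⟨⟨⟨_, hbot, htop, hand, hor, himp⟩, c1, c2, c3, c4⟩, hE⟩ := hA
  simp only [Alg.le, Alg.iff, htop, hand, hor, himp] at c1 c2 c3 c4 hE ⊢
  induction h with
  | imp_k => simp [Alg.eval, himp]
  | imp_s φ ψ γ =>
    simp only [Alg.eval, himp, himp_eq_top_iff, le_himp_iff]
    calc _ ≤ A.eval g φ ⊓ (A.eval g φ ⇨ A.eval g ψ) ⊓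
          (A.eval g φ ⇨ A.eval g ψ ⇨ A.eval g γ) := by
          refine le_inf (le_inf inf_le_right (inf_le_left.trans inf_le_right))
            (inf_le_left.trans inf_le_left)
      _ ≤ A.eval g φ ⊓ A.eval g ψ ⊓ (A.eval g φ ⇨ A.eval g ψ ⇨ A.eval g γ) := by
          rw [inf_himp]
      _ ≤ A.eval g γ := by
          rw [inf_right_comm, inf_himp, inf_right_comm, inf_assoc, inf_himp]
          exact inf_le_right.trans inf_le_right
  | and_left => simp [Alg.eval, himp, hand]
  | and_right => simp [Alg.eval, himp, hand]
  | and_intro => simp [Alg.eval, himp, hand]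
  | or_left => simp [Alg.eval, himp, hor]
  | or_right => simp [Alg.eval, himp, hor]
  | or_elim φ ψ γ =>
    simp only [Alg.eval, himp, hor, himp_eq_top_iff, le_himp_iff, sup_himp_distrib]
    exact le_rfl
  | bot_elim => simp [Alg.eval, himp, hbot]
  | top_intro => simp [Alg.eval, htop]
  | dne => simp [Alg.eval, Form.neg, himp, hbot]
  | l1 => simp [Alg.eval, c1]
  | l2 φ ψ γ =>
    simp only [Alg.eval, Form.iff, himp, hand, himp_eq_top_iff]
    exact inf_eq_left.1 (c2 _ _ _)
  | l3 φ ψ γ =>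
    simp only [Alg.eval, Form.iff, himp, hand, hor]
    exact c3 _ _ _
  | l4 φ ψ γ => simp [Alg.eval, Form.iff, himp, hand, c4]
  | ext l hl φ ψ => rw [A.eval_schema]; exact hE l hl _
  | mp _ _ ih₁ ih₂ => simpa [Alg.eval, himp, ih₁] using ih₂
  | wc γ _ ih =>
    simp only [Alg.eval, himp, himp_eq_top_iff] at ih ⊢
    rw [← inf_eq_left, ← c4, inf_eq_left.2 ih]

/-- Over the algebras of the variety of `E`, the deductive filters of the local logic are exactly the
nonempty lattice filters. -/
theorem isDeductiveFilter_iff {E : Set Letter} {A : Alg.{u}} (hA : A ∈ variety E)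
    (F : Set A.carrier) : A.IsDeductiveFilter (LV E) F ↔ A.IsLatticeFilter F := by
  constructor
  · intro hF
    refine ⟨⟨A.top, hF ∅ .top (.thm .top_intro) (fun _ => A.top) (by simp)⟩,
      fun x hx y hy => ?_, fun x hx y hxy => ?_⟩
    · let g : ℕ → A.carrier := fun n => if n = 0 then x else y
      refine hF {.var 0, .var 1} (.and (.var 0) (.var 1)) ?_ g (by simp [Alg.eval, g, hx, hy])
      exact .mp (.hyp (Or.inr rfl)) (.mp (.hyp (Or.inl rfl)) (.thm (.and_intro _ _)))
    · let g : ℕ → A.carrier := fun n => if n = 0 then x else y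
      refine hF {.and (.var 0) (.var 1)} (.var 1) ?_ g ?_
      · exact .mp (.hyp rfl) (.thm (.and_right _ _))
      · rintro _ rfl
        change A.and x y ∈ F
        rwa [hxy]
  · intro hF Γ φ h g hg
    obtain ⟨⟨_, -, htop, hand, -, himp⟩, -⟩ := hA.1
    induction h with
    | hyp h => exact hg _ h
    | thm h =>
      obtain ⟨x, hx⟩ := hF.nonempty
      refine hF.up_mem x hx _ ?_
      simp [Alg.le, thm_sound hA h, hand, htop]
    | @mp φ ψ _ _ ih₁ ih₂ =>
      refine hF.up_mem _ (hF.and_mem _ ih₁ _ ih₂) _ ?_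
      simp [Alg.le, Alg.eval, hand, himp]

/-! ### The four-element algebras -/

instance (p q : Bool × Bool) : DecidableEq (four p q).carrier :=
  inferInstanceAs (DecidableEq (Bool × Bool))

instance (p q : Bool × Bool) : Fintype (four p q).carrier :=
  inferInstanceAs (Fintype (Bool × Bool))

instance (p q : Bool × Bool) : BooleanAlgebra (four p q).carrier :=
  inferInstanceAs (BooleanAlgebra (Bool × Bool))

theorem four_isBoolean (p q : Bool × Bool) : (four p q).IsBoolean :=
  ⟨inferInstance, rfl, rfl, fun _ _ => rfl, fun _ _ => rfl,
    fun _ _ => rfl⟩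

instance (p q : Bool × Bool) (x y : (four p q).carrier) : Decidable ((four p q).le x y) :=
  inferInstanceAs (Decidable (_ = _))

theorem mem_variety_four {p q : Bool × Bool} {E : Set Letter} (hV : (four p q).IsVAlgebra)
    (hE : ∀ l ∈ E, ∀ x y : (four p q).carrier,
      (four p q).eval ![x, y] (l.schema (.var 0) (.var 1)) = (four p q).top) :
    four p q ∈ variety E := by
  refine ⟨hV, fun l hl h => ?_⟩
  rw [Alg.eval_schema]
  exact hE l hl _ _

theorem algA_mem : algA ∈ variety {.A}ᶜ := by
  refine mem_variety_four ⟨four_isBoolean _ _, by decide, by decide, by decide, by decide⟩ ?_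
  rintro (_ | _ | _ | _ | _ | _ | _) hl
  case A => simp at hl
  all_goals decide

theorem algB_mem : algB ∈ variety {.C, .S}ᶜ := by
  refine mem_variety_four ⟨four_isBoolean _ _, by decide, by decide, by decide, by decide⟩ ?_
  rintro (_ | _ | _ | _ | _ | _ | _) hl
  case C => simp at hl
  case S => simp at hl
  all_goals decide

theorem algC_mem : algC ∈ variety {.W, .C}ᶜ := by
  refine mem_variety_four ⟨four_isBoolean _ _, by decide, by decide, by decide, by decide⟩ ?_
  rintro (_ | _ | _ | _ | _ | _ | _) hl
  case C => simp at hl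
  case W => simp at hl
  all_goals decide

section Four

variable (p q : Bool × Bool)

theorem four_le_iff (x y : (four p q).carrier) : (four p q).le x y ↔ x ≤ y :=
  inf_eq_left

theorem four_box_eq_bot (x : (four p q).carrier) (hx : x ≠ (four p q).top) :
    (four p q).box x = (four p q).bot := by
  obtain ⟨_ | _, _ | _⟩ := x
  · rfl
  · rfl
  · rfl
  · exact absurd rfl hx

/-- The only congruences of `four p q` are equality and the total relation. -/
theorem four_simple (r : (four p q).carrier → (four p q).carrier → Prop)
    (hr : (four p q).IsCongruence r) : (∀ x y, r x y ↔ x = y) ∨ ∀ x y, r x y := by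
  have refl := hr.equivalence.refl
  by_cases h : ∀ x y, r x y → x = y
  · exact Or.inl fun x y => ⟨h x y, fun e => e ▸ refl x⟩
  right
  push Not at h
  obtain ⟨x, y, hxy, hne⟩ := h
  -- `z = (x ↔ y)` is a nontrivial element of the class of `1`, and so is `□z = 0`
  have hz : r ((four p q).iff x y) (four p q).top := by
    have h₁ := hr.and_congr _ _ _ _ (hr.imp_congr _ _ _ _ hxy (refl y))
      (hr.imp_congr _ _ _ _ (refl y) hxy)
    have h₂ : ∀ y : (four p q).carrier,
        (four p q).and ((four p q).imp y y) ((four p q).imp y y) = (four p q).top := by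
      rintro ⟨_ | _, _ | _⟩ <;> rfl
    rwa [h₂] at h₁
  have hz' : (four p q).iff x y ≠ (four p q).top := by
    intro h
    have h : bihimp x y = ⊤ := (inf_comm _ _).trans h
    exact hne (bihimp_eq_top.1 h)
  have h₀ : r (four p q).bot (four p q).top := by
    have h₁ := hr.cf_congr _ _ _ _ (hr.imp_congr _ _ _ _ hz (refl (four p q).bot)) hz
    have h₂ := four_box_eq_bot p q _ hz'
    unfold Alg.box Alg.neg at h₂
    rw [h₂] at h₁
    exact h₁
  have h₃ (x : (four p q).carrier) : r (four p q).bot x := by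
    have h₁ := hr.and_congr _ _ _ _ h₀ (refl x)
    have h₂ : (four p q).and (four p q).bot x = (four p q).bot :=
      bot_inf_eq x
    have h₄ : (four p q).and (four p q).top x = x := top_inf_eq x
    rwa [h₂, h₄] at h₁
  exact fun x y => hr.equivalence.trans (hr.equivalence.symm (h₃ x)) (h₃ y)

theorem four_isLatticeFilter_iff (F : Set (four p q).carrier) :
    (four p q).IsLatticeFilter F ↔ ∃ x, F = Set.Ici x := by
  constructor
  · intro hF
    -- an element with the fewest `true` coordinates is least in a filter, by closure under meets
    obtain ⟨x, hx, hmin⟩ := Set.exists_min_image F (fun z : Bool × Bool => z.1.toNat + z.2.toNat)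
      (Set.toFinite F) hF.nonempty
    refine ⟨x, Set.ext fun y => ⟨fun hy => ?_, fun hy => hF.up_mem x hx y ?_⟩⟩
    · have key : ∀ x y : Bool × Bool,
          x.1.toNat + x.2.toNat ≤ (x ⊓ y).1.toNat + (x ⊓ y).2.toNat → x ≤ y := by decide
      exact key x y (hmin _ (hF.and_mem x hx y hy))
    · exact (four_le_iff p q _ _).2 hy
  · rintro ⟨x, rfl⟩
    refine ⟨⟨x, Set.self_mem_Ici⟩, fun y hy z hz => ?_, fun y hy z hyz => ?_⟩
    · exact le_inf (Set.mem_Ici.1 hy) (Set.mem_Ici.1 hz)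
    · exact (Set.mem_Ici.1 hy).trans ((four_le_iff p q _ _).1 hyz)

theorem four_isOpenFilter_iff (F : Set (four p q).carrier) :
    (four p q).IsOpenFilter F ↔ F = {(four p q).top} ∨ F = Set.univ := by
  constructor
  · rintro ⟨hF, hbox⟩
    obtain ⟨x, hx⟩ := hF.nonempty
    have htop : (four p q).top ∈ F :=
      hF.up_mem x hx _ ((four_le_iff p q _ _).2 le_top)
    by_cases h : ∃ z ∈ F, z ≠ (four p q).top
    · obtain ⟨z, hz, hne⟩ := h
      have h₀ := hbox z hz
      rw [four_box_eq_bot p q z hne] at h₀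
      exact Or.inr (Set.eq_univ_of_forall fun y =>
        hF.up_mem _ h₀ y ((four_le_iff p q _ _).2 bot_le))
    · push Not at h
      exact Or.inl (Set.ext fun y => ⟨h y, fun hy => hy ▸ htop⟩)
  · rintro (rfl | rfl)
    · refine ⟨(four_isLatticeFilter_iff p q _).2 ⟨⊤, ?_⟩, ?_⟩
      · exact (Set.Ici_top).symm
      · rintro _ rfl
        rfl
    · refine ⟨(four_isLatticeFilter_iff p q _).2 ⟨⊥, ?_⟩, fun _ _ => trivial⟩
      exact (Set.Ici_bot).symm

theorem four_isCongruenceFilter_iff (F : Set (four p q).carrier) :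
    (four p q).IsCongruenceFilter F ↔ (four p q).IsOpenFilter F := by
  rw [four_isOpenFilter_iff]
  constructor
  · rintro ⟨r, hr, rfl⟩
    rcases four_simple p q r hr with h | h
    · exact Or.inl (Set.ext fun x => h x _)
    · exact Or.inr (Set.eq_univ_of_forall fun x => h x _)
  · rintro (rfl | rfl)
    · refine ⟨Eq, ⟨eq_equivalence, ?_, ?_, ?_, ?_⟩, rfl⟩ <;> rintro _ _ _ _ rfl rfl <;> rfl
    · exact ⟨fun _ _ => True, ⟨⟨fun _ => trivial, fun _ => trivial, fun _ _ => trivial⟩,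
        fun _ _ _ _ _ _ => trivial, fun _ _ _ _ _ _ => trivial, fun _ _ _ _ _ _ => trivial,
        fun _ _ _ _ _ _ => trivial⟩, Set.ofPred_true.symm⟩

theorem four_card_latticeFilters : {F | (four p q).IsLatticeFilter F}.ncard = 4 := by
  have : {F | (four p q).IsLatticeFilter F} = Set.range Set.Ici := by
    ext F
    refine (four_isLatticeFilter_iff p q F).trans ?_
    exact exists_congr fun x => eq_comm
  rw [this, ← Set.image_univ, Set.ncard_image_of_injective _ Set.Ici_injective, Set.ncard_univ,
    Nat.card_eq_fintype_card]
  rfl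

theorem four_card_openFilters : {F | (four p q).IsOpenFilter F}.ncard = 2 := by
  have : {F | (four p q).IsOpenFilter F} = {{(four p q).top}, Set.univ} :=
    Set.ext fun F => four_isOpenFilter_iff p q F
  rw [this, Set.ncard_pair]
  intro h
  have : (four p q).bot ∈ ({(four p q).top} : Set (four p q).carrier) := h ▸ trivial
  exact absurd (Set.mem_singleton_iff.1 this) (bot_ne_top (α := Bool × Bool))

theorem filterMismatch_four {E : Set Letter} (h : four p q ∈ variety E) :
    FilterMismatch E (four p q) :=
  ⟨h, isDeductiveFilter_iff h, four_isCongruenceFilter_iff p q, four_card_latticeFilters p q,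
    four_card_openFilters p q⟩

/-- `four p q` has more deductive filters than congruences. -/
theorem not_algebraizable_of_four_mem {E : Set Letter} (h : four p q ∈ variety E) :
    ¬ Algebraizable.{u} (LV E) := by
  have hF (x : (four p q).carrier) : (four p q).IsDeductiveFilter (LV E) (Set.Ici x) :=
    (isDeductiveFilter_iff h _).2 ((four_isLatticeFilter_iff p q _).2 ⟨x, rfl⟩)
  have hne {x y : (four p q).carrier} (hxy : x ≠ y) : Set.Ici x ≠ Set.Ici y :=
    fun e => hxy (Set.Ici_injective e)
  refine not_algebraizable_of_simple (four_simple p q) (hF (false, false)) (hF (true, false))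
    (hF (true, true)) (hne ?_) (hne ?_) (hne ?_) <;> rintro ⟨⟩

end Four

theorem exists_four_mem_variety {E : Set Letter}
    (hE : ¬ (.A ∈ E ∧ (.C ∈ E ∨ (.W ∈ E ∧ .S ∈ E)))) : ∃ p q, four p q ∈ variety E := by
  by_cases hA : Letter.A ∈ E
  · have hC : Letter.C ∉ E := fun hC => hE ⟨hA, Or.inl hC⟩
    by_cases hW : Letter.W ∈ E
    · have hS : Letter.S ∉ E := fun hS => hE ⟨hA, Or.inr ⟨hW, hS⟩⟩
      refine ⟨_, _, variety_anti ?_ algB_mem⟩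
      rintro l hl (rfl | rfl)
      exacts [hC hl, hS hl]
    · refine ⟨_, _, variety_anti ?_ algC_mem⟩
      rintro l hl (rfl | rfl)
      exacts [hW hl, hC hl]
  · refine ⟨_, _, variety_anti ?_ algA_mem⟩
    rintro l hl rfl
    exact hA hl

/-! ### Maximal consistent sets -/

theorem Der.mono {E : Set Letter} {Γ Δ : Set (Form ℕ)} {φ : Form ℕ} (h : Γ ⊆ Δ)
    (hφ : Der E Γ φ) : Der E Δ φ :=
  hφ.cut fun _ hδ => .hyp (h hδ)

theorem Der.deduction {E : Set Letter} {Γ : Set (Form ℕ)} {φ ψ : Form ℕ}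
    (h : Der E (insert φ Γ) ψ) : Der E Γ (.imp φ ψ) := by
  induction h with
  | hyp h =>
    rcases h with h | h
    · rw [h]
      exact .thm (.mp (.imp_k _ φ) (.mp (.imp_k _ (.imp φ φ)) (.imp_s _ _ _)))
    · exact .mp (.hyp h) (.thm (.imp_k _ _))
  | thm h => exact .mp (.thm h) (.thm (.imp_k _ _))
  | mp _ _ ih₁ ih₂ => exact .mp ih₁ (.mp ih₂ (.thm (.imp_s _ _ _)))

theorem Der.thm_of_empty {E : Set Letter} {φ : Form ℕ} (h : Der E ∅ φ) : Thm E φ := by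
  induction h with
  | hyp h => exact absurd h (Set.notMem_empty _)
  | thm h => exact h
  | mp _ _ ih₁ ih₂ => exact .mp ih₁ ih₂

/-- Maximal consistent sets of formulas with respect to the local logic `LV E`. -/
def IsMaxConsistent (E : Set Letter) (Δ : Set (Form ℕ)) : Prop :=
  Maximal (fun Δ => ¬ Der E Δ .bot) Δ

/-- Lindenbaum's lemma. -/
theorem exists_isMaxConsistent {E : Set Letter} {Γ : Set (Form ℕ)} {φ : Form ℕ}
    (h : ¬ Der E Γ φ) : ∃ Δ, IsMaxConsistent E Δ ∧ Γ ⊆ Δ ∧ φ.neg ∈ Δ := by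
  have h₀ : ¬ Der E (insert φ.neg Γ) .bot := fun hb => h (.mp hb.deduction (.thm (.dne _)))
  obtain ⟨Δ, hΔ, hmax⟩ := zorn_subset_nonempty {Δ | ¬ Der E Δ .bot} (fun c hc hch hne => by
    refine ⟨⋃₀ c, fun hb => ?_, fun s hs => Set.subset_sUnion_of_mem hs⟩
    obtain ⟨Γ', hΓ', hfin, hd⟩ := hb.finitary
    obtain ⟨s, hs, hsub⟩ := DirectedOn.exists_mem_subset_of_finite_of_subset_sUnion hne
      hch.directedOn hfin hΓ'
    exact hc hs (hd.mono hsub)) _ h₀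
  exact ⟨Δ, hmax, (Set.subset_insert _ _).trans hΔ, hΔ (Set.mem_insert _ _)⟩

namespace IsMaxConsistent

variable {E : Set Letter} {Δ : Set (Form ℕ)} {φ ψ γ : Form ℕ}

theorem mem_of_der (hΔ : IsMaxConsistent E Δ) (h : Der E Δ φ) : φ ∈ Δ := by
  refine hΔ.le_of_ge (y := insert φ Δ) (fun hb => hΔ.prop (.mp h hb.deduction))
    (Set.subset_insert _ _) (Set.mem_insert _ _)

theorem mem_of_thm (hΔ : IsMaxConsistent E Δ) (h : Thm E φ) : φ ∈ Δ :=
  hΔ.mem_of_der (.thm h)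

theorem mem_of_imp_mem (hΔ : IsMaxConsistent E Δ) (h : .imp φ ψ ∈ Δ) (hφ : φ ∈ Δ) : ψ ∈ Δ :=
  hΔ.mem_of_der (.mp (.hyp hφ) (.hyp h))

theorem bot_notMem (hΔ : IsMaxConsistent E Δ) : .bot ∉ Δ :=
  fun h => hΔ.prop (.hyp h)

theorem imp_mem_iff (hΔ : IsMaxConsistent E Δ) : .imp φ ψ ∈ Δ ↔ (φ ∈ Δ → ψ ∈ Δ) := by
  refine ⟨hΔ.mem_of_imp_mem, fun h => ?_⟩
  by_cases hφ : φ ∈ Δ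
  · exact hΔ.mem_of_der (.mp (.hyp (h hφ)) (.thm (.imp_k _ _)))
  · have hb : Der E (insert φ Δ) .bot := by
      by_contra hb
      exact hφ (hΔ.le_of_ge hb (Set.subset_insert _ _) (Set.mem_insert _ _))
    exact hΔ.mem_of_der (Der.deduction (.mp hb (.thm (.bot_elim _))))

theorem neg_mem_iff (hΔ : IsMaxConsistent E Δ) : φ.neg ∈ Δ ↔ φ ∉ Δ := by
  rw [Form.neg, hΔ.imp_mem_iff]
  simp [hΔ.bot_notMem]

theorem and_mem_iff (hΔ : IsMaxConsistent E Δ) : .and φ ψ ∈ Δ ↔ φ ∈ Δ ∧ ψ ∈ Δ :=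
  ⟨fun h => ⟨hΔ.mem_of_imp_mem (hΔ.mem_of_thm (.and_left _ _)) h,
    hΔ.mem_of_imp_mem (hΔ.mem_of_thm (.and_right _ _)) h⟩,
  fun h => hΔ.mem_of_imp_mem
    (hΔ.mem_of_imp_mem (hΔ.mem_of_thm (.and_intro _ _)) h.1) h.2⟩

theorem or_mem_iff (hΔ : IsMaxConsistent E Δ) : .or φ ψ ∈ Δ ↔ φ ∈ Δ ∨ ψ ∈ Δ := by
  constructor
  · intro h
    by_contra! hn
    have h₁ := hΔ.imp_mem_iff (φ := φ) (ψ := .bot) |>.2 fun h => absurd h hn.1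
    have h₂ := hΔ.imp_mem_iff (φ := ψ) (ψ := .bot) |>.2 fun h => absurd h hn.2
    exact hΔ.bot_notMem (hΔ.mem_of_imp_mem (hΔ.mem_of_imp_mem (hΔ.mem_of_imp_mem
      (hΔ.mem_of_thm (.or_elim _ _ _)) h₁) h₂) h)
  · rintro (h | h)
    · exact hΔ.mem_of_imp_mem (hΔ.mem_of_thm (.or_left _ _)) h
    · exact hΔ.mem_of_imp_mem (hΔ.mem_of_thm (.or_right _ _)) h

theorem iff_mem_iff (hΔ : IsMaxConsistent E Δ) : φ.iff ψ ∈ Δ ↔ (φ ∈ Δ ↔ ψ ∈ Δ) := by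
  rw [Form.iff, hΔ.and_mem_iff, hΔ.imp_mem_iff, hΔ.imp_mem_iff]
  exact iff_iff_implies_and_implies.symm

end IsMaxConsistent

theorem thm_of_forall_mem {E : Set Letter} {φ : Form ℕ}
    (h : ∀ Δ, IsMaxConsistent E Δ → φ ∈ Δ) : Thm E φ := by
  by_contra hφ
  obtain ⟨Δ, hΔ, -, hn⟩ := exists_isMaxConsistent (Γ := ∅) fun hd => hφ hd.thm_of_empty
  exact hΔ.neg_mem_iff.1 hn (h Δ hΔ)

/-! ### The collapse of the counterfactual -/

namespace IsMaxConsistent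

variable {E : Set Letter} {Δ : Set (Form ℕ)} {φ ψ γ : Form ℕ}

theorem cf_mem_mono (hΔ : IsMaxConsistent E Δ)
    (h : ∀ Δ, IsMaxConsistent E Δ → φ ∈ Δ → ψ ∈ Δ) (hφ : .cf γ φ ∈ Δ) : .cf γ ψ ∈ Δ :=
  hΔ.mem_of_imp_mem (hΔ.mem_of_thm
    (.wc γ (thm_of_forall_mem fun Δ hΔ => hΔ.imp_mem_iff.2 (h Δ hΔ)))) hφ

theorem cf_mem_congr_left (hΔ : IsMaxConsistent E Δ)
    (h : ∀ Δ, IsMaxConsistent E Δ → (φ ∈ Δ ↔ ψ ∈ Δ)) : .cf φ γ ∈ Δ ↔ .cf ψ γ ∈ Δ := by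
  refine hΔ.iff_mem_iff.1 (hΔ.mem_of_imp_mem (hΔ.mem_of_thm (.l2 φ ψ γ))
    (hΔ.and_mem_iff.2 ⟨?_, ?_⟩))
  · exact hΔ.cf_mem_mono (fun Δ hΔ => (h Δ hΔ).1) (hΔ.mem_of_thm (.l1 φ))
  · exact hΔ.cf_mem_mono (fun Δ hΔ => (h Δ hΔ).2) (hΔ.mem_of_thm (.l1 ψ))

/-- Schema `C`, in the form: `φ □→ ψ` agrees with `ψ` wherever `φ` is true. It also follows from `W`
and `S`. -/
theorem cf_mem_iff_of_mem (hE : .C ∈ E ∨ (.W ∈ E ∧ .S ∈ E)) (hΔ : IsMaxConsistent E Δ)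
    (hφ : φ ∈ Δ) : .cf φ ψ ∈ Δ ↔ ψ ∈ Δ := by
  rcases hE with hC | ⟨hW, hS⟩
  · have h := hΔ.mem_of_thm (.ext .C hC φ ψ)
    simp only [Letter.schema, hΔ.and_mem_iff, hΔ.imp_mem_iff] at h
    exact ⟨fun h' => h.1 h' hφ, fun h' => h.2 ⟨hφ, h'⟩⟩
  · have hw (ψ) : .cf φ ψ ∈ Δ → ψ ∈ Δ := fun h' => by
      have h := hΔ.mem_of_thm (.ext .W hW φ ψ)
      simp only [Letter.schema, hΔ.imp_mem_iff] at h
      exact h h' hφ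
    refine ⟨hw ψ, fun hψ => ?_⟩
    have h := hΔ.mem_of_thm (.ext .S hS φ ψ)
    rw [Letter.schema, hΔ.or_mem_iff] at h
    exact h.resolve_right fun h' => hΔ.neg_mem_iff.1 (hw _ h') hψ

theorem preceq_neg_mem_iff (hE : .C ∈ E ∨ (.W ∈ E ∧ .S ∈ E)) (hΔ : IsMaxConsistent E Δ) :
    φ.preceq φ.neg ∈ Δ ↔ φ ∈ Δ := by
  have ht : .or φ φ.neg ∈ Δ := by
    rw [hΔ.or_mem_iff, hΔ.neg_mem_iff]
    exact em _
  simp only [Form.preceq, Form.might, hΔ.imp_mem_iff, hΔ.neg_mem_iff,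
    cf_mem_iff_of_mem hE hΔ ht, not_not, ht, forall_true_left]

/-- Schema `A`, applied to `φ ≼ ¬φ`, makes every truth necessary. -/
theorem box_mem (hA : .A ∈ E) (hE : .C ∈ E ∨ (.W ∈ E ∧ .S ∈ E)) (hΔ : IsMaxConsistent E Δ)
    (hφ : φ ∈ Δ) : φ.box ∈ Δ := by
  have h := hΔ.mem_of_thm (.ext .A hA φ φ.neg)
  rw [Letter.schema, hΔ.and_mem_iff, hΔ.imp_mem_iff] at h
  have h₁ := h.1 ((preceq_neg_mem_iff hE hΔ).2 hφ)
  rw [Form.box, hΔ.cf_mem_congr_left (ψ := φ.neg) fun Δ hΔ => by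
    rw [hΔ.neg_mem_iff, hΔ.neg_mem_iff, preceq_neg_mem_iff hE hΔ]] at h₁
  exact hΔ.cf_mem_mono (fun Δ hΔ => (preceq_neg_mem_iff hE hΔ).1) h₁

theorem cf_mem_iff (hA : .A ∈ E) (hE : .C ∈ E ∨ (.W ∈ E ∧ .S ∈ E)) (hΔ : IsMaxConsistent E Δ) :
    .cf φ ψ ∈ Δ ↔ (φ ∈ Δ → ψ ∈ Δ) := by
  refine ⟨fun h hφ => (cf_mem_iff_of_mem hE hΔ hφ).1 h, fun h => ?_⟩
  by_cases hφ : φ ∈ Δ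
  · exact (cf_mem_iff_of_mem hE hΔ hφ).2 (h hφ)
  · -- `□¬φ` holds, so that `φ` counterfactually implies a contradiction
    have h₁ := box_mem hA hE hΔ (hΔ.neg_mem_iff.2 hφ)
    rw [Form.box, hΔ.cf_mem_congr_left (ψ := φ) fun Δ hΔ => by
      rw [hΔ.neg_mem_iff, hΔ.neg_mem_iff, not_not]] at h₁
    have h₂ := hΔ.iff_mem_iff.1 (hΔ.mem_of_thm (.l4 φ φ φ.neg)) |>.2
      (hΔ.and_mem_iff.2 ⟨hΔ.mem_of_thm (.l1 φ), h₁⟩)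
    refine hΔ.cf_mem_mono (fun Δ hΔ h => ?_) h₂
    rw [hΔ.and_mem_iff, hΔ.neg_mem_iff] at h
    exact absurd h.1 h.2

theorem truth_iff_mem (hA : .A ∈ E) (hE : .C ∈ E ∨ (.W ∈ E ∧ .S ∈ E))
    (hΔ : IsMaxConsistent E Δ) (φ : Form ℕ) : φ.Truth (fun n => .var n ∈ Δ) ↔ φ ∈ Δ := by
  induction φ with
  | var => rfl
  | bot => simp [Form.Truth, hΔ.bot_notMem]
  | top => simp [Form.Truth, hΔ.mem_of_thm .top_intro]
  | and _ _ ih₁ ih₂ => simp [Form.Truth, hΔ.and_mem_iff, ih₁, ih₂]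
  | or _ _ ih₁ ih₂ => simp [Form.Truth, hΔ.or_mem_iff, ih₁, ih₂]
  | imp _ _ ih₁ ih₂ => simp [Form.Truth, hΔ.imp_mem_iff, ih₁, ih₂]
  | cf _ _ ih₁ ih₂ => simp [Form.Truth, hΔ.cf_mem_iff hA hE, ih₁, ih₂]

end IsMaxConsistent

/-- Every one of the logics is sound for material implication. -/
theorem Thm.truth {E : Set Letter} {φ : Form ℕ} (h : Thm E φ) (v : ℕ → Prop) : φ.Truth v := by
  induction h with
  | ext l hl φ ψ =>
    cases l <;> simp only [Letter.schema, Form.preceq, Form.prec, Form.might, Form.dia, Form.box,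
      Form.neg, Form.Truth] <;> tauto
  | mp _ _ ih₁ ih₂ => exact ih₂ ih₁
  | _ => simp only [Form.iff, Form.neg, Form.Truth] at * <;> tauto

theorem Der.truth {E : Set Letter} {Γ : Set (Form ℕ)} {φ : Form ℕ} (h : Der E Γ φ)
    (v : ℕ → Prop) (hv : ∀ γ ∈ Γ, γ.Truth v) : φ.Truth v := by
  induction h with
  | hyp h => exact hv _ h
  | thm h => exact h.truth v
  | mp _ _ ih₁ ih₂ => exact ih₂ ih₁

theorem der_iff_truth {E : Set Letter} (hE : .A ∈ E ∧ (.C ∈ E ∨ (.W ∈ E ∧ .S ∈ E)))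
    (Γ : Set (Form ℕ)) (φ : Form ℕ) :
    Der E Γ φ ↔ ∀ v : ℕ → Prop, (∀ γ ∈ Γ, γ.Truth v) → φ.Truth v := by
  refine ⟨Der.truth, fun h => ?_⟩
  by_contra hφ
  obtain ⟨Δ, hΔ, hΓ, hn⟩ := exists_isMaxConsistent hφ
  have ht := IsMaxConsistent.truth_iff_mem hE.1 hE.2 hΔ
  exact hΔ.neg_mem_iff.1 hn ((ht φ).1 (h _ fun γ hγ => (ht γ).2 (hΓ hγ)))

theorem LV_eq_LVCA {E : Set Letter} (hE : .A ∈ E ∧ (.C ∈ E ∨ (.W ∈ E ∧ .S ∈ E))) :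
    LV E = LV {.C, .A} := by
  ext Γ φ
  exact (der_iff_truth hE Γ φ).trans (der_iff_truth (by simp) Γ φ).symm

/-! ### Classical logic is algebraizable -/

/-- The two-element algebra of truth values, with `□→` interpreted as implication. -/
def two : Alg.{u} where
  carrier := ULift.{u} Prop
  bot := ⟨False⟩
  top := ⟨True⟩
  and x y := ⟨x.down ∧ y.down⟩
  or x y := ⟨x.down ∨ y.down⟩
  imp x y := ⟨x.down → y.down⟩
  cf x y := ⟨x.down → y.down⟩

theorem two_eval (h : ℕ → two.{u}.carrier) (φ : Form ℕ) :
    two.eval h φ = ⟨φ.Truth fun n => ULift.down (h n)⟩ := by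
  induction φ with
  | var | bot | top => rfl
  | and _ _ ih₁ ih₂ | or _ _ ih₁ ih₂ | imp _ _ ih₁ ih₂ | cf _ _ ih₁ ih₂ =>
    simp only [Alg.eval, ih₁, ih₂]
    rfl

theorem two_sat_iff (h : ℕ → two.{u}.carrier) (e : Equation ℕ) :
    two.Sat h e ↔ ((e.1.Truth fun n => ULift.down (h n)) ↔ e.2.Truth fun n => ULift.down (h n)) := by
  rw [Alg.Sat, two_eval, two_eval]
  exact ULift.up_inj.trans eq_iff_iff

/-- The quasivariety generated by the two-element algebra. -/
def quasivarietyOfTwo : Set Alg.{u} :=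
  {A | ∀ q ∈ {q | two.{u}.Validates q}, A.Validates q}

theorem two_mem_quasivarietyOfTwo : two.{u} ∈ quasivarietyOfTwo :=
  fun _ hq => hq

theorem mem_transEqSet_top {Γ : Set (Form ℕ)} {e : Equation ℕ} :
    e ∈ transEqSet {(.var 0, .top)} Γ ↔ ∃ γ ∈ Γ, (γ, .top) = e := by
  simp [transEqSet, transEq, Form.subst, eq_comm]

/-- A logic which is two-valued consequence is algebraizable, with defining equation `x ≈ 1` and
equivalence formula `x ↔ y`. By finitarity, each of its entailments is a quasiequation valid in the
two-element algebra. -/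
theorem algebraizable_of_der_iff_truth {L : Logic}
    (hL : ∀ Γ φ, L.Entails Γ φ ↔ ∀ v : ℕ → Prop, (∀ γ ∈ Γ, γ.Truth v) → φ.Truth v) :
    Algebraizable.{u} L := by
  have hΔ : transForm {Form.iff (.var 0) (.var 1)} (.var 0) (.var 1) =
      {Form.iff (.var 0) (.var 1)} := by
    simp [transForm, Form.iff, Form.subst]
  refine ⟨quasivarietyOfTwo, {(.var 0, .top)}, {Form.iff (.var 0) (.var 1)},
    ⟨_, rfl⟩, Set.finite_singleton _, Set.finite_singleton _, fun Γ φ => ⟨fun h => ?_, fun h => ?_⟩,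
    ?_, ?_⟩
  · obtain ⟨Γ', hsub, hfin, hd⟩ := L.finitary h
    intro A hA g hg e he
    obtain rfl : (φ, Form.top) = e := by
      simpa [transEq, Form.subst, eq_comm] using he
    refine hA ⟨hfin.toFinset.toList.map fun γ => (γ, .top), (φ, .top)⟩ ?_ g ?_
    · intro v hv
      rw [two_sat_iff]
      refine iff_of_true ((hL _ _).1 hd _ fun γ hγ => ?_) trivial
      exact ((two_sat_iff v _).1 (hv (γ, .top) (by simpa using hγ))).2 trivial
    · intro e he
      simp only [List.mem_map, Finset.mem_toList, Set.Finite.mem_toFinset] at he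
      obtain ⟨γ, hγ, rfl⟩ := he
      exact hg _ (mem_transEqSet_top.2 ⟨γ, hsub hγ, rfl⟩)
  · rw [hL]
    intro v hv
    have := h two two_mem_quasivarietyOfTwo (fun n => ⟨v n⟩) (fun e he => by
      obtain ⟨γ, hγ, rfl⟩ := mem_transEqSet_top.1 he
      exact (two_sat_iff _ _).2 (iff_of_true (hv γ hγ) trivial)) (φ, .top)
      (by simp [transEq, Form.subst])
    exact ((two_sat_iff _ _).1 this).2 trivial
  · rw [hΔ]
    intro A hA g hg e he
    obtain ⟨_, rfl, rfl⟩ := mem_transEqSet_top.1 he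
    refine hA ⟨[(.var 0, .var 1)], (Form.iff (.var 0) (.var 1), .top)⟩ ?_ g (by simpa using hg)
    intro v hv
    have := (two_sat_iff v _).1 (hv _ (List.mem_singleton.2 rfl))
    rw [two_sat_iff]
    exact iff_of_true ⟨this.1, this.2⟩ trivial
  · rw [hΔ]
    rintro A hA g hg e rfl
    refine hA ⟨[(Form.iff (.var 0) (.var 1), .top)], (.var 0, .var 1)⟩ ?_ g ?_
    · intro v hv
      have := ((two_sat_iff v _).1 (hv _ (List.mem_singleton.2 rfl))).2 trivial
      rw [two_sat_iff]
      exact ⟨this.1, this.2⟩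
    · intro e he
      obtain rfl := List.mem_singleton.1 he
      exact hg _ (mem_transEqSet_top.2 ⟨_, rfl, rfl⟩)

theorem algebraizable_LV_iff (E : Set Letter) :
    Algebraizable.{u} (LV E) ↔ .A ∈ E ∧ (.C ∈ E ∨ (.W ∈ E ∧ .S ∈ E)) := by
  refine ⟨fun h => ?_, fun hE => algebraizable_of_der_iff_truth (der_iff_truth hE)⟩
  by_contra hE
  obtain ⟨p, q, hpq⟩ := exists_four_mem_variety hE
  exact not_algebraizable_of_four_mem p q hpq h

theorem LV_eq_LVCA_iff (E : Set Letter) :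
    LV E = LV {.C, .A} ↔ .A ∈ E ∧ (.C ∈ E ∨ (.W ∈ E ∧ .S ∈ E)) := by
  refine ⟨fun h => ?_, LV_eq_LVCA⟩
  rw [← algebraizable_LV_iff.{0}, h, algebraizable_LV_iff]
  simp

end LewisLogic

theorem mainTheorem7 :
    -- an extension of LV is algebraizable only if it is the logic LVCA, and LVCA is algebraizable
    (∀ E : Set LewisLogic.Letter,
      LewisLogic.Algebraizable.{u} (LewisLogic.LV E) ↔
        LewisLogic.LV E = LewisLogic.LV {.C, .A}) ∧
    -- the sets of schemata that give the exceptional logic LVCA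
    (∀ E : Set LewisLogic.Letter,
      LewisLogic.LV E = LewisLogic.LV {.C, .A} ↔ .A ∈ E ∧ (.C ∈ E ∨ (.W ∈ E ∧ .S ∈ E))) ∧
    -- in particular LV, LVC and LVCS are not algebraizable
    (¬ LewisLogic.Algebraizable.{u} (LewisLogic.LV ∅) ∧
      ¬ LewisLogic.Algebraizable.{u} (LewisLogic.LV {.C}) ∧
      ¬ LewisLogic.Algebraizable.{u} (LewisLogic.LV {.C, .S})) ∧
    -- the four-element algebras in VCSU, VWA and VTSA
    (LewisLogic.FilterMismatch {.C, .S, .U} LewisLogic.algA ∧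
      LewisLogic.FilterMismatch {.W, .A} LewisLogic.algB ∧
      LewisLogic.FilterMismatch {.T, .S, .A} LewisLogic.algC) ∧
    -- LVCA is classical logic, with the counterfactual collapsing to material implication
    (∀ (Γ : Set (LewisLogic.Form ℕ)) (φ : LewisLogic.Form ℕ),
      (LewisLogic.LV {.C, .A}).Entails Γ φ ↔
        ∀ v : ℕ → Prop, (∀ γ ∈ Γ, γ.Truth v) → φ.Truth v) := by
  open LewisLogic in
  refine ⟨fun E => (algebraizable_LV_iff E).trans (LV_eq_LVCA_iff E).symm, LV_eq_LVCA_iff,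
    ⟨?_, ?_, ?_⟩, ⟨?_, ?_, ?_⟩, der_iff_truth (by simp)⟩
  · simp [algebraizable_LV_iff]
  · simp [algebraizable_LV_iff]
  · simp [algebraizable_LV_iff]
  · refine filterMismatch_four _ _ (variety_anti ?_ algA_mem)
    rintro _ (rfl | rfl | rfl) <;> simp
  · refine filterMismatch_four _ _ (variety_anti ?_ algB_mem)
    rintro _ (rfl | rfl) <;> simp
  · refine filterMismatch_four _ _ (variety_anti ?_ algC_mem)
    rintro _ (rfl | rfl | rfl) <;> simp
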